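/- Let $S$ be a semigroup. For a finite alphabet $X$, a finite choice of generators for $S$ is a surjective morphism $\sigma : X^+ \to S$ from the free semigroup on $X$ onto $S$. Let $S^1$ be $S$ with a new identity element $1$ adjoined (even if $S$ already has one), and let $\sigma^1 : X^* \to S^1$ be the extension of $\sigma$ to the free monoid. Let $\overline{X} = \{\overline{x} \mid x \in X\}$ be a disjoint copy of $X$. The loop automaton of $S$ with respect to $\sigma$ has state set $S^1$, has for all $a \in S^1$ and $x \in X$ an edge from $a$ to $a(x\sigma^1)$ labelled $x$ and an edge from $a(x\sigma^1)$ to $a$ labelled $\overline{x}$, and has $1$ as its start state and only terminal state. The loop problem $L_\sigma(S) \subseteq (X \cup \overline{X})^*$ is the language it accepts. We say that $S$ has context-free loop problem if $L_\tau(S)$ is a context-free language for some finite choice of generators $\tau : Y^+ \to S$. For $R \subseteq X^+$, the multiplication table of $S$ with respect to $\sigma$ and $R$ is the language $$\{\, u \# v \# w^{\mathrm{rev}} \mid u, v, w \in R,\ (uv)\sigma = w\sigma \,\}$$ over $X \cup \{\#\}$, where $\# \notin X$ is a new symbol and $w^{\mathrm{rev}}$ denotes $w$ written backwards. The semigroup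 $S$ is word hyperbolic in the sense of Duncan and Gilman if there are a finite choice of generators $\sigma : X^+ \to S$ and a regular language $R \subseteq X^+$ with $R\sigma = S$ such that the multiplication table of $S$ with respect to $\sigma$ and $R$ is context-free. **Proposition.** Let $S$ be a semigroup with context-free loop problem. Then for every finite choice of generators $\sigma : X^+ \to S$, the multiplication table of $S$ with respect to $\sigma$ and $X^+$ is context-free. In particular, $S$ is word hyperbolic in the sense of Duncan and Gilman. -/

import Mathlib

universe u v

namespace LoopProblem

section Automaton

variable {X : Type u} {M : Type v} [Monoid M]

/-- The (right) loop automaton of a monoid `M` with respect to a choice of monoid generators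
`σ : X* → M`, over the alphabet `X ⊕ X`, where `Sum.inl x` is the letter `x` and `Sum.inr x` is
its formal inverse. The states are the elements of `M`. There is an edge from `a` to `b` labelled
`x` if `a (x σ) = b` (this is the Cayley graph), and then an inverse edge from `b` to `a` labelled
by the formal inverse of `x`. The identity is the start state and the only terminal state. -/
def loopAutomaton (σ : FreeMonoid X →* M) : NFA (X ⊕ X) M where
  step
    | a, Sum.inl x => {b | a * σ (FreeMonoid.of x) = b}
    | b, Sum.inr x => {a | a * σ (FreeMonoid.of x) = b}
  start := {1}
  accept := {1}

/-- The loop problem of a monoid: the language recognised by its loop automaton. -/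
def monoidLoopProblem (σ : FreeMonoid X →* M) : Language (X ⊕ X) :=
  (loopAutomaton σ).accepts

end Automaton

section Semigroup

variable {X : Type u} {S : Type v} [Semigroup S]

/-- The extension `σ¹ : X* → S¹` of `σ : X⁺ → S`. Here `S¹ = WithOne S` is `S` with a new identity
adjoined, even if `S` already has one. -/
def extendOne (σ : FreeSemigroup X →ₙ* S) : FreeMonoid X →* WithOne S :=
  FreeMonoid.lift fun x => (σ (FreeSemigroup.of x) : WithOne S)

/-- `σ¹` really extends `σ`. -/
theorem extendOne_toFreeMonoid (σ : FreeSemigroup X →ₙ* S) (w : FreeSemigroup X) :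
    extendOne σ w.toFreeMonoid = (σ w : WithOne S) := by
  induction w using FreeSemigroup.recOnMul with
  | ih1 x => simp [extendOne]
  | ih2 x y hx hy => rw [map_mul, map_mul, hx, hy, map_mul, WithOne.coe_mul]

/-- The loop problem of a semigroup `S` with respect to a choice of generators `σ : X⁺ → S`. -/
def loopProblem (σ : FreeSemigroup X →ₙ* S) : Language (X ⊕ X) :=
  monoidLoopProblem (extendOne σ)

/-- A non-empty word, as a list of letters. -/
def wordList (w : FreeSemigroup X) : List X :=
  FreeMonoid.toList w.toFreeMonoid

/-- The multiplication table of `S` with respect to `σ : X⁺ → S` and `R ⊆ X⁺`: the language of all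
words `u # v # wᴿ` with `u, v, w ∈ R` and `(u v) σ = w σ`, where `wᴿ` is the reverse of `w`.
It is a language over `Option X`, in which `some x` is the letter `x` and `none` is the new
symbol `#`. -/
def multiplicationTable (σ : FreeSemigroup X →ₙ* S) (R : Set (FreeSemigroup X)) :
    Language (Option X) :=
  {z | ∃ u ∈ R, ∃ v ∈ R, ∃ w ∈ R, σ (u * v) = σ w ∧
    z = (wordList u).map some ++ [none] ++ (wordList v).map some ++ [none] ++
      (wordList w).reverse.map some}

end Semigroup

/-- `S` is finitely generated and has context-free loop problem: for some finite choice of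
generators `σ : Y⁺ → S`, the loop problem of `S` with respect to `σ` is context-free. -/
def HasContextFreeLoopProblem (S : Type v) [Semigroup S] : Prop :=
  ∃ (Y : Type) (_ : Finite Y) (σ : FreeSemigroup Y →ₙ* S),
    Function.Surjective σ ∧ (loopProblem σ).IsContextFree

/-- `S` is word hyperbolic in the sense of Duncan and Gilman: there are a finite choice of
generators `σ : Y⁺ → S` and a regular language `R ⊆ Y⁺` with `R σ = S`, such that the
multiplication table of `S` with respect to `σ` and `R` is context-free. -/
def IsWordHyperbolic (S : Type v) [Semigroup S] : Prop :=
  ∃ (Y : Type) (_ : Finite Y) (σ : FreeSemigroup Y →ₙ* S) (R : Set (FreeSemigroup Y)),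
    Function.Surjective σ ∧ σ '' R = Set.univ ∧
    Language.IsRegular (wordList '' R : Language Y) ∧
    (multiplicationTable σ R).IsContextFree

end LoopProblem

/-! For words `a`, `b` over `Y`, the word `a` followed by the formal inverse of `b` labels a loop at
1 exactly when `a` and `b` have the same value in S¹: the forward edges lead from 1 to the value of
`a` only, and the inverse edges trace `b` backwards (`append_mem_monoidLoopProblem`). Choose φ(x) ∈
Y⁺ with φ(x)τ = xσ. Then u # v # wᴿ belongs to the table for X⁺ exactly when φ(u)φ(v) followed by
the formal inverse of φ(w) belongs to the loop problem of τ.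

So the table is the image of a context-free language under a finite transducer that guesses a
factorisation into blocks φ(x) and inserts #. Such images are context-free (`isContextFree_wordRun`)
by the triple construction: (p, A, q) generates the outputs of runs from p to q on words derived
from A. Every transition reads a non-empty word, so there are no moves with empty input to
eliminate. Word hyperbolicity follows with R = X⁺, which is regular. -/

namespace LoopProblem

/-! ### Transducers acting on sentential forms -/

section Transducer

variable {T Γ N Q : Type*}

/-- Runs of a transducer with transition relation `δ`: there is a transition from `p` to `q` reading
the letter `t` and writing the word `o` if `δ p t o q`. -/
inductive LetterRun (δ : Q → T → List Γ → Q → Prop) : Q → List T → List Γ → Q → Prop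
  | nil (p : Q) : LetterRun δ p [] [] p
  | cons {p q r : Q} {t : T} {o : List Γ} {w : List T} {z : List Γ} :
      δ p t o q → LetterRun δ q w z r → LetterRun δ p (t :: w) (o ++ z) r

/-- The images of a sentential form under a transducer, where a nonterminal `A` is replaced by
some `(p, A, q)`, representing the images of words derived from `A` along runs from `p` to `q`. -/
inductive Expands (δ : Q → T → List Γ → Q → Prop) :
    Q → List (Symbol T N) → List (Symbol Γ (Q × N × Q)) → Q → Prop
  | nil (p : Q) : Expands δ p [] [] p
  | terminal {p q r : Q} {t : T} {o : List Γ} {s : List (Symbol T N)}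
      {s' : List (Symbol Γ (Q × N × Q))} :
      δ p t o q → Expands δ q s s' r →
        Expands δ p (Symbol.terminal t :: s) (o.map Symbol.terminal ++ s') r
  | nonterminal {p q r : Q} {A : N} {s : List (Symbol T N)}
      {s' : List (Symbol Γ (Q × N × Q))} :
      Expands δ q s s' r →
        Expands δ p (Symbol.nonterminal A :: s) (Symbol.nonterminal (p, A, q) :: s') r

variable {δ : Q → T → List Γ → Q → Prop}

theorem Expands.append {p q r : Q} {s₁ s₂ : List (Symbol T N)}
    {s₁' s₂' : List (Symbol Γ (Q × N × Q))} (h₁ : Expands δ p s₁ s₁' q)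
    (h₂ : Expands δ q s₂ s₂' r) : Expands δ p (s₁ ++ s₂) (s₁' ++ s₂') r := by
  induction h₁ with
  | nil => exact h₂
  | terminal h _ ih => rw [List.append_assoc]; exact .terminal h (ih h₂)
  | nonterminal _ ih => exact .nonterminal (ih h₂)

theorem Expands.exists_of_append {p r : Q} {s₁ s₂ : List (Symbol T N)}
    {s' : List (Symbol Γ (Q × N × Q))} (h : Expands δ p (s₁ ++ s₂) s' r) :
    ∃ q s₁' s₂', s' = s₁' ++ s₂' ∧ Expands δ p s₁ s₁' q ∧ Expands δ q s₂ s₂' r := by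
  induction s₁ generalizing p s' with
  | nil => exact ⟨p, [], s', rfl, .nil p, h⟩
  | cons a s₁ ih =>
    rw [List.cons_append] at h
    cases h with
    | terminal ht h =>
      obtain ⟨q, s₁', s₂', rfl, h₁, h₂⟩ := ih h
      exact ⟨q, _, s₂', (List.append_assoc _ _ _).symm, .terminal ht h₁, h₂⟩
    | nonterminal h =>
      obtain ⟨q, s₁', s₂', rfl, h₁, h₂⟩ := ih h
      exact ⟨q, _, s₂', rfl, .nonterminal h₁, h₂⟩

/-- This lets a rewriting step of the image grammar be pulled back: a triple names both its source
nonterminal and the states around it. -/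
theorem Expands.exists_of_nonterminal {p r p₁ q₁ : Q} {A : N} {s : List (Symbol T N)}
    {s' x y : List (Symbol Γ (Q × N × Q))} (h : Expands δ p s s' r)
    (hs' : s' = x ++ Symbol.nonterminal (p₁, A, q₁) :: y) :
    ∃ s₁ s₂, s = s₁ ++ Symbol.nonterminal A :: s₂ ∧ Expands δ p s₁ x p₁ ∧
      Expands δ q₁ s₂ y r := by
  induction h generalizing x with
  | nil => simp at hs'
  | @terminal p q r t o s s' ht h ih =>
    rcases List.append_eq_append_iff.mp hs' with ⟨a, rfl, ha⟩ | ⟨a, ha, ha'⟩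
    · obtain ⟨s₁, s₂, rfl, h₁, h₂⟩ := ih ha
      exact ⟨_ :: s₁, s₂, rfl, .terminal ht h₁, h₂⟩
    · cases a with
      | nil =>
        obtain ⟨s₁, s₂, rfl, h₁, h₂⟩ := ih (x := []) (by simpa using ha'.symm)
        refine ⟨_ :: s₁, s₂, rfl, ?_, h₂⟩
        have := Expands.terminal ht h₁
        simpa [ha] using this
      | cons b a =>
        obtain ⟨rfl, -⟩ : b = Symbol.nonterminal (p₁, A, q₁) ∧ a ++ s' = y := by
          simpa [eq_comm] using ha'
        -- The triple would lie inside the output of a transition, which has only terminals.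
        have : Symbol.nonterminal (p₁, A, q₁) ∈ o.map (Symbol.terminal (N := Q × N × Q)) := by
          simp [ha]
        simp at this
  | @nonterminal p q r B s s' h ih =>
    cases x with
    | nil =>
      simp only [List.nil_append, List.cons.injEq, Symbol.nonterminal.injEq, Prod.mk.injEq] at hs'
      obtain ⟨⟨rfl, rfl, rfl⟩, rfl⟩ := hs'
      exact ⟨[], s, rfl, .nil _, h⟩
    | cons b x =>
      simp only [List.cons_append, List.cons.injEq] at hs'
      obtain ⟨rfl, hs'⟩ := hs'
      obtain ⟨s₁, s₂, rfl, h₁, h₂⟩ := ih hs'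
      exact ⟨_ :: s₁, s₂, rfl, .nonterminal h₁, h₂⟩

theorem LetterRun.expands {p q : Q} {w : List T} {z : List Γ} (h : LetterRun δ p w z q) :
    Expands (N := N) δ p (w.map Symbol.terminal) (z.map Symbol.terminal) q := by
  induction h with
  | nil p => exact .nil p
  | cons ht _ ih => rw [List.map_append]; exact .terminal ht ih

theorem Expands.exists_letterRun {p q : Q} {s : List (Symbol T N)}
    {s' : List (Symbol Γ (Q × N × Q))} (h : Expands δ p s s' q) {z : List Γ}
    (hz : s' = z.map Symbol.terminal) :
    ∃ w : List T, s = w.map Symbol.terminal ∧ LetterRun δ p w z q := by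
  induction h generalizing z with
  | nil p =>
    obtain rfl : z = [] := List.map_eq_nil_iff.mp hz.symm
    exact ⟨[], rfl, .nil p⟩
  | terminal ht h ih =>
    obtain ⟨z₁, z₂, rfl, h₁, h₂⟩ := List.map_eq_append_iff.mp hz.symm
    obtain rfl := List.map_injective_iff.mpr (fun _ _ hab => Symbol.terminal.inj hab) h₁
    obtain ⟨w, rfl, hw⟩ := ih h₂.symm
    exact ⟨_ :: w, rfl, .cons ht hw⟩
  | nonterminal h ih => cases z <;> simp at hz

/-- Each symbol of `s` leaves a choice of next state and, for a terminal, of output; both choices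
are finite. -/
theorem Expands.finite [Finite Q] (hδ : ∀ p t q, {o | δ p t o q}.Finite) (p : Q)
    (s : List (Symbol T N)) (r : Q) : {s' | Expands δ p s s' r}.Finite := by
  induction s generalizing p with
  | nil =>
    refine (Set.finite_singleton []).subset ?_
    rintro s' ⟨⟩
    rfl
  | cons a s ih =>
    cases a with
    | terminal t =>
      refine (Set.finite_iUnion fun q => (hδ p t q).image2
        (fun o s' => o.map Symbol.terminal ++ s') (ih q)).subset ?_
      intro s' hs'
      cases hs' with
      | terminal ht h => exact Set.mem_iUnion.mpr ⟨_, _, ht, _, h, rfl⟩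
    | nonterminal A =>
      refine (Set.finite_iUnion fun q => (ih q).image
        (fun s' => Symbol.nonterminal (p, A, q) :: s')).subset ?_
      intro s' hs'
      cases hs' with
      | nonterminal h => exact Set.mem_iUnion.mpr ⟨_, _, h, rfl⟩

end Transducer

/-! ### The triple construction -/

section TripleConstruction

variable {T Γ : Type*} {Q : Type} [Finite Q] {δ : Q → T → List Γ → Q → Prop}

/-- The rules of the image of a context-free grammar under a transducer. -/
def imageRules (g : ContextFreeGrammar T) (δ : Q → T → List Γ → Q → Prop) :
    Set (ContextFreeRule Γ (Q × g.NT × Q)) :=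
  {r' | ∃ r ∈ g.rules, ∃ p q s', Expands δ p r.output s' q ∧ r' = ⟨(p, r.input, q), s'⟩}

theorem imageRules_finite (g : ContextFreeGrammar T) (hδ : ∀ p t q, {o | δ p t o q}.Finite) :
    (imageRules g δ).Finite := by
  refine (g.rules.finite_toSet.biUnion fun r _ => Set.finite_iUnion fun p =>
    Set.finite_iUnion fun q => (Expands.finite hδ p r.output q).image
      (fun s' => ContextFreeRule.mk (p, r.input, q) s')).subset ?_
  rintro _ ⟨r, hr, p, q, s', h, rfl⟩
  simp only [Set.mem_iUnion]
  exact ⟨r, hr, p, q, s', h, rfl⟩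

/-- The image of a context-free grammar under a transducer with start state `i` and terminal
state `f`. -/
noncomputable def imageGrammar (g : ContextFreeGrammar T)
    (hδ : ∀ p t q, {o | δ p t o q}.Finite) (i f : Q) : ContextFreeGrammar Γ where
  NT := Q × g.NT × Q
  initial := (i, g.initial, f)
  rules := (imageRules_finite g hδ).toFinset

variable {g : ContextFreeGrammar T} {hδ : ∀ p t q, {o | δ p t o q}.Finite} {i f : Q}

/-- The induction runs back from the end of the derivation, since the states are given only for `w`.
Undoing a rule merges the expansion of its output into one triple with the same end states. -/
theorem imageGrammar_derives_of_derives {s w : List (Symbol T g.NT)} (h : g.Derives s w)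
    {p q : Q} {w' : List (Symbol Γ (Q × g.NT × Q))} (hw : Expands δ p w w' q) :
    ∃ s', Expands δ p s s' q ∧ (imageGrammar g hδ i f).Derives s' w' := by
  induction h using Relation.ReflTransGen.head_induction_on with
  | refl => exact ⟨w', hw, .refl _⟩
  | head h _ ih =>
    obtain ⟨s', hs', hd⟩ := ih
    obtain ⟨r, hr, hrw⟩ := h
    obtain ⟨x, y, rfl, rfl⟩ := hrw.exists_parts
    obtain ⟨q₁, _, y', rfl, hxo, hy⟩ := hs'.exists_of_append
    obtain ⟨p₁, x', o', rfl, hx, ho⟩ := hxo.exists_of_append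
    refine ⟨x' ++ [Symbol.nonterminal (p₁, r.input, q₁)] ++ y', ?_, ?_⟩
    · exact (hx.append (.nonterminal (.nil _))).append hy
    · refine ContextFreeGrammar.Produces.trans_derives ⟨⟨(p₁, r.input, q₁), o'⟩, ?_, ?_⟩ hd
      · exact (imageRules_finite g hδ).mem_toFinset.mpr ⟨r, hr, p₁, q₁, o', ho, rfl⟩
      · exact ContextFreeRule.rewrites_of_exists_parts _ x' y'

theorem derives_of_imageGrammar_derives {s' w' : List (Symbol Γ (Q × g.NT × Q))}
    (h : (imageGrammar g hδ i f).Derives s' w') {s : List (Symbol T g.NT)} {p q : Q}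
    (hs : Expands δ p s s' q) : ∃ w, g.Derives s w ∧ Expands δ p w w' q := by
  induction h with
  | refl => exact ⟨s, .refl _, hs⟩
  | tail _ h ih =>
    obtain ⟨v, hv, hve⟩ := ih
    obtain ⟨_, hr', hrw⟩ := h
    obtain ⟨r, hr, p₁, q₁, o', ho, rfl⟩ := (imageRules_finite g hδ).mem_toFinset.mp hr'
    obtain ⟨x', y', rfl, rfl⟩ := hrw.exists_parts
    obtain ⟨x, y, rfl, hx, hy⟩ := hve.exists_of_nonterminal (by simp; rfl)
    refine ⟨x ++ r.output ++ y, hv.trans_produces ⟨r, hr, ?_⟩, (hx.append ho).append hy⟩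
    simpa using r.rewrites_of_exists_parts x y

/-- The image of a context-free language under a finite transducer is context-free. -/
theorem isContextFree_letterRun {L : Language T} (hL : L.IsContextFree)
    (hδ : ∀ p t q, {o | δ p t o q}.Finite) (i f : Q) :
    Language.IsContextFree ({z | ∃ w ∈ L, LetterRun δ i w z f} : Language Γ) := by
  obtain ⟨g, rfl⟩ := hL
  refine ⟨imageGrammar g hδ i f, Set.ext fun z => ⟨fun hz => ?_, ?_⟩⟩
  · obtain ⟨s, hs, hse⟩ := derives_of_imageGrammar_derives
      (s := [Symbol.nonterminal g.initial]) hz (.nonterminal (.nil f))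
    obtain ⟨w, rfl, hw⟩ := hse.exists_letterRun rfl
    exact ⟨w, hs, hw⟩
  · rintro ⟨w, hw, hz⟩
    obtain ⟨s', hs', hd⟩ := imageGrammar_derives_of_derives (hδ := hδ) (i := i) (f := f) hw
      hz.expands
    cases hs' with
    | nonterminal h => cases h with
      | nil => exact hd

end TripleConstruction

/-! ### From transitions reading words to transitions reading letters -/

section WordTransducer

/-- Runs of a transducer whose transitions read words: there is a transition from `p` to `q`
reading `a` and writing `o` if `δ p a o q`. -/
inductive WordRun {T Γ P : Type*} (δ : P → List T → List Γ → P → Prop) :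
    P → List T → List Γ → P → Prop
  | nil (p : P) : WordRun δ p [] [] p
  | cons {p q r : P} {a : List T} {o : List Γ} {w : List T} {z : List Γ} :
      δ p a o q → WordRun δ q w z r → WordRun δ p (a ++ w) (o ++ z) r

variable {T P : Type} {Γ : Type*} {δ : P → List T → List Γ → P → Prop} {n : ℕ}

/-- The transducer reading single letters that simulates one reading words of length at most `n`.
Its states carry the part of the current word that is still to be read. -/
def residualStep (δ : P → List T → List Γ → P → Prop) (n : ℕ) :
    P × {l : List T // l.length ≤ n} → T → List Γ → P × {l : List T // l.length ≤ n} → Prop :=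
  fun a t o b => (a.2.1 = t :: b.2.1 ∧ o = [] ∧ a.1 = b.1) ∨ (a.2.1 = [] ∧ δ a.1 (t :: b.2.1) o b.1)

/-- The pending word of `a` is consumed first; since nothing is pending at `b`, the rest splits into
complete transition inputs. -/
theorem LetterRun.exists_wordRun {a b : P × {l : List T // l.length ≤ n}} {w : List T}
    {z : List Γ} (h : LetterRun (residualStep δ n) a w z b) (hb : b.2.1 = []) :
    ∃ w', w = a.2.1 ++ w' ∧ WordRun δ a.1 w' z b.1 := by
  induction h with
  | nil p => exact ⟨[], by simp [hb], .nil _⟩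
  | cons h _ ih =>
    obtain ⟨w', rfl, hw'⟩ := ih hb
    rcases h with ⟨ha, rfl, hp⟩ | ⟨ha, hd⟩
    · exact ⟨w', by simp [ha], by simpa [hp] using hw'⟩
    · exact ⟨_, by simp [ha], .cons hd hw'⟩

theorem letterRun_of_residual {p : P} {b : P × {l : List T // l.length ≤ n}} {w : List T}
    {z : List Γ} (h : LetterRun (residualStep δ n) (p, ⟨[], n.zero_le⟩) w z b) (l : List T)
    (hl : l.length ≤ n) : LetterRun (residualStep δ n) (p, ⟨l, hl⟩) (l ++ w) z b := by
  induction l with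
  | nil => exact h
  | cons t l ih =>
    exact .cons (q := (p, ⟨l, (Nat.le_succ _).trans hl⟩)) (o := []) (.inl ⟨rfl, rfl, rfl⟩) (ih _)

theorem WordRun.letterRun (hn : ∀ p a o q, δ p a o q → a ≠ [] ∧ a.length ≤ n) {p q : P}
    {w : List T} {z : List Γ} (h : WordRun δ p w z q) :
    LetterRun (residualStep δ n) (p, ⟨[], n.zero_le⟩) w z (q, ⟨[], n.zero_le⟩) := by
  induction h with
  | nil p => exact .nil _
  | @cons p q r a o w z h _ ih =>
    obtain ⟨h₁, h₂⟩ := hn _ _ _ _ h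
    obtain ⟨t, l, rfl⟩ := List.exists_cons_of_ne_nil h₁
    exact .cons (q := (q, ⟨l, (Nat.le_succ _).trans h₂⟩)) (.inr ⟨rfl, h⟩)
      (letterRun_of_residual ih l _)

/-- The image of a context-free language under a finite transducer, all of whose transitions read
a non-empty word, is context-free. -/
theorem isContextFree_wordRun [Finite T] [Finite P] {L : Language T} (hL : L.IsContextFree)
    (hn : ∀ p a o q, δ p a o q → a ≠ [] ∧ a.length ≤ n) (hδ : ∀ p a q, {o | δ p a o q}.Finite)
    (i f : P) : Language.IsContextFree ({z | ∃ w ∈ L, WordRun δ i w z f} : Language Γ) := by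
  have : Finite {l : List T // l.length ≤ n} := (List.finite_length_le T n).to_subtype
  have hfin : ∀ a t b, {o | residualStep δ n a t o b}.Finite := by
    intro a t b
    refine ((Set.finite_singleton []).union (hδ a.1 (t :: b.2.1) b.1)).subset ?_
    rintro o (⟨-, rfl, -⟩ | ⟨-, h⟩)
    · exact .inl rfl
    · exact .inr h
  have key := isContextFree_letterRun hL hfin (i, ⟨[], n.zero_le⟩) (f, ⟨[], n.zero_le⟩)
  have heq : ∀ z w, LetterRun (residualStep δ n) (i, ⟨[], n.zero_le⟩) w z (f, ⟨[], n.zero_le⟩) ↔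
      WordRun δ i w z f := by
    refine fun z w => ⟨fun h => ?_, fun h => h.letterRun hn⟩
    obtain ⟨w', rfl, hw'⟩ := h.exists_wordRun rfl
    exact hw'
  simpa only [heq] using key

end WordTransducer

/-! ### Loops that read a positive word, then a negative one -/

section LoopProblem

variable {X M : Type*} [Monoid M]

theorem evalFrom_map_inl (σ : FreeMonoid X →* M) (a : List X) (m : M) :
    (loopAutomaton σ).evalFrom {m} (a.map Sum.inl) = {m * σ (FreeMonoid.ofList a)} := by
  induction a generalizing m with
  | nil => simp
  | cons x a ih =>
    have : (loopAutomaton σ).stepSet {m} (Sum.inl x) = {m * σ (FreeMonoid.of x)} := by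
      ext b
      simp [NFA.stepSet, loopAutomaton, eq_comm]
    rw [List.map_cons, NFA.evalFrom_cons, this, ih, FreeMonoid.ofList_cons, map_mul, mul_assoc]

/-- Inverse edges are nondeterministic, but an inverse path ending at `m`, traversed backwards, is
the unique forward path from `m` labelled `b`. -/
theorem mem_evalFrom_map_inr (σ : FreeMonoid X →* M) (b : List X) (B : Set M) (m : M) :
    m ∈ (loopAutomaton σ).evalFrom B (b.reverse.map Sum.inr) ↔
      m * σ (FreeMonoid.ofList b) ∈ B := by
  induction b generalizing m with
  | nil => simp
  | cons x b ih =>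
    rw [List.reverse_cons, List.map_append, NFA.evalFrom_append, List.map_singleton,
      NFA.evalFrom_singleton, NFA.mem_stepSet, FreeMonoid.ofList_cons, map_mul, ← mul_assoc, ← ih]
    simp [loopAutomaton]

theorem append_mem_monoidLoopProblem (σ : FreeMonoid X →* M) (a b : List X) :
    a.map Sum.inl ++ b.reverse.map Sum.inr ∈ monoidLoopProblem σ ↔
      σ (FreeMonoid.ofList a) = σ (FreeMonoid.ofList b) := by
  rw [monoidLoopProblem, NFA.mem_accepts, NFA.evalFrom_append]
  have hs : (loopAutomaton σ).start = {1} := rfl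
  have ha : (loopAutomaton σ).accept = {1} := rfl
  rw [hs, ha, evalFrom_map_inl]
  simp only [Set.mem_singleton_iff, exists_eq_left, mem_evalFrom_map_inr, one_mul]
  exact eq_comm

end LoopProblem

/-! ### The transducer producing the table -/

section Table

variable {X Y : Type*} {φ : X → List Y}

/-- The states of the transducer producing the multiplication table. -/
inductive Phase
  | start
  | left
  | right
  | result

instance : Finite Phase :=
  Finite.of_surjective (fun n : Fin 4 => match n with
    | 0 => Phase.start
    | 1 => Phase.left
    | 2 => Phase.right
    | 3 => Phase.result) (by
      rintro (_ | _ | _ | _)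
      exacts [⟨0, rfl⟩, ⟨1, rfl⟩, ⟨2, rfl⟩, ⟨3, rfl⟩])

/-- The transitions of the transducer producing words `u # v # wᴿ` from the words over `Y` and its
formal inverses that spell out `u`, `v` and the inverse of `w` via `φ`. -/
inductive TableStep (φ : X → List Y) : Phase → List (Y ⊕ Y) → List (Option X) → Phase → Prop
  | start (x : X) : TableStep φ .start ((φ x).map Sum.inl) [some x] .left
  | left (x : X) : TableStep φ .left ((φ x).map Sum.inl) [some x] .left
  | left_right (x : X) : TableStep φ .left ((φ x).map Sum.inl) [none, some x] .right
  | right (x : X) : TableStep φ .right ((φ x).map Sum.inl) [some x] .right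
  | right_result (x : X) :
      TableStep φ .right ((φ x).reverse.map Sum.inr) [none, some x] .result
  | result (x : X) : TableStep φ .result ((φ x).reverse.map Sum.inr) [some x] .result

/-- A description of the runs of the table transducer from a given phase to the last one. -/
def IsTableRun (φ : X → List Y) : Phase → List (Y ⊕ Y) → List (Option X) → Prop
  | .result, W, z => ∃ w : List X, W = (w.flatMap φ).reverse.map Sum.inr ∧ z = w.reverse.map some
  | .right, W, z => ∃ v w : List X, w ≠ [] ∧
      W = (v.flatMap φ).map Sum.inl ++ (w.flatMap φ).reverse.map Sum.inr ∧
      z = v.map some ++ [none] ++ w.reverse.map some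
  | .left, W, z => ∃ u v w : List X, v ≠ [] ∧ w ≠ [] ∧
      W = ((u ++ v).flatMap φ).map Sum.inl ++ (w.flatMap φ).reverse.map Sum.inr ∧
      z = u.map some ++ [none] ++ v.map some ++ [none] ++ w.reverse.map some
  | .start, W, z => ∃ u v w : List X, u ≠ [] ∧ v ≠ [] ∧ w ≠ [] ∧
      W = ((u ++ v).flatMap φ).map Sum.inl ++ (w.flatMap φ).reverse.map Sum.inr ∧
      z = u.map some ++ [none] ++ v.map some ++ [none] ++ w.reverse.map some

theorem WordRun.isTableRun {p q : Phase} {W : List (Y ⊕ Y)} {z : List (Option X)}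
    (h : WordRun (TableStep φ) p W z q) (hq : q = .result) : IsTableRun φ p W z := by
  induction h with
  | nil p => subst hq; exact ⟨[], rfl, rfl⟩
  | cons h _ ih =>
    specialize ih hq
    cases h with
    | start x =>
      obtain ⟨u, v, w, hv, hw, rfl, rfl⟩ := ih
      exact ⟨x :: u, v, w, by simp, hv, hw, by simp, by simp⟩
    | left x =>
      obtain ⟨u, v, w, hv, hw, rfl, rfl⟩ := ih
      exact ⟨x :: u, v, w, hv, hw, by simp, by simp⟩
    | left_right x =>
      obtain ⟨v, w, hw, rfl, rfl⟩ := ih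
      exact ⟨[], x :: v, w, by simp, hw, by simp, by simp⟩
    | right x =>
      obtain ⟨v, w, hw, rfl, rfl⟩ := ih
      exact ⟨x :: v, w, hw, by simp, by simp⟩
    | right_result x =>
      obtain ⟨w, rfl, rfl⟩ := ih
      -- The inverse of a word starts with its last letter, so the letter read first goes at the
      -- end.
      exact ⟨[], w ++ [x], by simp, by simp, by simp⟩
    | result x =>
      obtain ⟨w, rfl, rfl⟩ := ih
      exact ⟨w ++ [x], by simp, by simp⟩

theorem wordRun_result (w : List X) :
    WordRun (TableStep φ) .result ((w.flatMap φ).reverse.map Sum.inr) (w.reverse.map some)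
      .result := by
  induction w using List.reverseRecOn with
  | nil => exact .nil _
  | append_singleton w x ih => simpa using WordRun.cons (.result x) ih

theorem wordRun_right (v w : List X) (hw : w ≠ []) :
    WordRun (TableStep φ) .right
      ((v.flatMap φ).map Sum.inl ++ (w.flatMap φ).reverse.map Sum.inr)
      (v.map some ++ [none] ++ w.reverse.map some) .result := by
  induction v with
  | nil =>
    cases w using List.reverseRecOn with
    | nil => exact absurd rfl hw
    | append_singleton w x => simpa using WordRun.cons (.right_result x) (wordRun_result w)
  | cons x v ih => simpa using WordRun.cons (.right x) ih

theorem wordRun_left (u v w : List X) (hv : v ≠ []) (hw : w ≠ []) :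
    WordRun (TableStep φ) .left
      (((u ++ v).flatMap φ).map Sum.inl ++ (w.flatMap φ).reverse.map Sum.inr)
      (u.map some ++ [none] ++ v.map some ++ [none] ++ w.reverse.map some) .result := by
  induction u with
  | nil =>
    cases v with
    | nil => exact absurd rfl hv
    -- The separator is emitted together with the first letter of `v`, which avoids a transition
    -- with empty input and is why `v` must be non-empty.
    | cons x v => simpa using WordRun.cons (.left_right x) (wordRun_right v w hw)
  | cons x u ih => simpa using WordRun.cons (.left x) ih

theorem wordRun_start (u v w : List X) (hu : u ≠ []) (hv : v ≠ []) (hw : w ≠ []) :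
    WordRun (TableStep φ) .start
      (((u ++ v).flatMap φ).map Sum.inl ++ (w.flatMap φ).reverse.map Sum.inr)
      (u.map some ++ [none] ++ v.map some ++ [none] ++ w.reverse.map some) .result := by
  cases u with
  | nil => exact absurd rfl hu
  | cons x u => simpa using WordRun.cons (.start x) (wordRun_left u v w hv hw)

theorem TableStep.finite [Finite X] (p : Phase) (a : List (Y ⊕ Y)) (q : Phase) :
    {o | TableStep φ p a o q}.Finite := by
  refine ((Set.finite_range fun x : X => [some x]).union
    (Set.finite_range fun x : X => [none, some x])).subset ?_
  rintro o h
  cases h <;> simp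

end Table

/-! ### The table as an image of the loop problem -/

section MultiplicationTable

variable {X Y S : Type*} [Semigroup S]

theorem wordList_mul (u v : FreeSemigroup X) : wordList (u * v) = wordList u ++ wordList v := by
  simp [wordList]

theorem wordList_eq_cons (w : FreeSemigroup X) : wordList w = w.head :: w.tail := by
  induction w using FreeSemigroup.recOnMul with
  | ih1 x => simp [wordList]
  | ih2 x y hx hy => simp [wordList_mul, hx, hy]

theorem wordList_ne_nil (w : FreeSemigroup X) : wordList w ≠ [] := by
  simp [wordList_eq_cons]

theorem exists_wordList_eq {l : List X} (hl : l ≠ []) : ∃ w : FreeSemigroup X, wordList w = l := by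
  obtain ⟨x, l, rfl⟩ := List.exists_cons_of_ne_nil hl
  exact ⟨⟨x, l⟩, wordList_eq_cons _⟩

theorem extendOne_ofList_wordList (σ : FreeSemigroup X →ₙ* S) (w : FreeSemigroup X) :
    extendOne σ (FreeMonoid.ofList (wordList w)) = (σ w : WithOne S) :=
  extendOne_toFreeMonoid σ w

theorem extendOne_ofList_flatMap {σ : FreeSemigroup X →ₙ* S} {τ : FreeSemigroup Y →ₙ* S}
    {φ : X → FreeSemigroup Y} (hφ : ∀ x, τ (φ x) = σ (FreeSemigroup.of x)) (l : List X) :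
    extendOne τ (FreeMonoid.ofList (l.flatMap fun x => wordList (φ x))) =
      extendOne σ (FreeMonoid.ofList l) := by
  induction l with
  | nil => simp
  | cons x l ih =>
    rw [List.flatMap_cons, FreeMonoid.ofList_append, map_mul, ih, extendOne_ofList_wordList, hφ,
      FreeMonoid.ofList_cons, map_mul]
    simp [extendOne]

theorem isContextFree_multiplicationTable {S : Type v} [Semigroup S]
    (hS : HasContextFreeLoopProblem S) {X : Type u} [Finite X] (σ : FreeSemigroup X →ₙ* S) :
    (multiplicationTable σ Set.univ).IsContextFree := by
  obtain ⟨Y, _, τ, hτ, hL⟩ := hS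
  choose φ hφ using fun x => hτ (σ (FreeSemigroup.of x))
  -- A common bound on the block lengths exists as `X` is finite; it keeps the set of pending words
  -- finite.
  obtain ⟨n, hn⟩ := (Set.finite_range fun x => (wordList (φ x)).length).bddAbove
  replace hn : ∀ x, (wordList (φ x)).length ≤ n := fun x => hn ⟨x, rfl⟩
  have key := isContextFree_wordRun (n := n) (δ := TableStep fun x => wordList (φ x)) hL ?_
    TableStep.finite .start .result
  · refine cast (congrArg Language.IsContextFree ?_) key
    symm
    have hmem (u v w : FreeSemigroup X) :
        ((wordList u ++ wordList v).flatMap fun x => wordList (φ x)).map Sum.inl ++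
          ((wordList w).flatMap fun x => wordList (φ x)).reverse.map Sum.inr ∈ loopProblem τ ↔
        σ (u * v) = σ w := by
      rw [loopProblem, append_mem_monoidLoopProblem, extendOne_ofList_flatMap hφ,
        extendOne_ofList_flatMap hφ, ← wordList_mul, extendOne_ofList_wordList,
        extendOne_ofList_wordList, WithOne.coe_inj]
    refine Set.ext fun z => ⟨?_, ?_⟩
    · rintro ⟨u, -, v, -, w, -, h, rfl⟩
      exact ⟨_, (hmem u v w).mpr h, wordRun_start _ _ _ (wordList_ne_nil u) (wordList_ne_nil v)
        (wordList_ne_nil w)⟩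
    · rintro ⟨W, hW, h⟩
      obtain ⟨u, v, w, hu, hv, hw, rfl, rfl⟩ := h.isTableRun rfl
      obtain ⟨u, rfl⟩ := exists_wordList_eq hu
      obtain ⟨v, rfl⟩ := exists_wordList_eq hv
      obtain ⟨w, rfl⟩ := exists_wordList_eq hw
      exact ⟨u, trivial, v, trivial, w, trivial, (hmem u v w).mp hW, rfl⟩
  · intro p a o q h
    cases h <;> simp [wordList_ne_nil, hn]

theorem isRegular_wordList_univ (X : Type*) :
    Language.IsRegular (wordList '' (Set.univ : Set (FreeSemigroup X)) : Language X) := by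
  -- The state records whether a letter has been read.
  let D : DFA X Bool := ⟨fun _ _ => true, false, {true}⟩
  have hD (l : List X) : D.evalFrom true l = true := by
    induction l with
    | nil => rfl
    | cons x l ih => exact ih
  refine Language.isRegular_iff.mpr ⟨Bool, inferInstance, D, Set.ext fun l => ⟨fun h => ?_, ?_⟩⟩
  · obtain ⟨w, hw⟩ : ∃ w : FreeSemigroup X, wordList w = l := by
      refine exists_wordList_eq ?_
      rintro rfl
      exact Bool.false_ne_true h
    exact ⟨w, trivial, hw⟩
  · rintro ⟨w, -, rfl⟩
    rw [wordList_eq_cons]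
    exact hD w.tail

end MultiplicationTable

end LoopProblem

theorem mainTheorem11 {S : Type v} [Semigroup S]
    (hS : LoopProblem.HasContextFreeLoopProblem S) :
    (∀ (X : Type u) [Finite X] (σ : FreeSemigroup X →ₙ* S), Function.Surjective σ →
      (LoopProblem.multiplicationTable σ Set.univ).IsContextFree) ∧
    LoopProblem.IsWordHyperbolic S := by
  refine ⟨fun X _ σ _ => LoopProblem.isContextFree_multiplicationTable hS σ, ?_⟩
  obtain ⟨Y, hY, σ, hσ, -⟩ := id hS
  exact ⟨Y, hY, σ, Set.univ, hσ, Set.image_univ_of_surjective hσ,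
    LoopProblem.isRegular_wordList_univ Y, LoopProblem.isContextFree_multiplicationTable hS σ⟩
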